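/- Let $L_h\in\mathbb R^{m\times m}$ be symmetric positive semidefinite (in particular, $L_h$ may be symmetric positive definite), let $\langle u,v\rangle=v^Tu$ on $\mathbb R^m$ with norm $\|\cdot\|$, and let $g,G:\mathbb R^m\to\mathbb R^m$ be such that $G$ has non-negative entries, $v\mapsto\langle G(v),1\rangle$ is differentiable with gradient $-g(v)$ at every $v\in\mathbb R^m$ (where $1=(1,\dots,1)^T$), and $g$ is Lipschitz-continuous with respect to $\|\cdot\|$ with a constant $\ell_g>0$. Put $$E[u]=\tfrac12\langle u,L_hu\rangle+\langle G(u),1\rangle .$$ Let $\kappa\ge 2\ell_g$, $L_\kappa=L_h+\kappa I$ and $g_\kappa(u)=\kappa u+g(u)$, and apply to $u_h'=-L_\kappa u_h+g_\kappa(u_h)$, with arbitrary (possibly variable) step sizes $\tau=\tau_n>0$ and $U^{n,1}=u_h^{n-1}$, $u_h^n=U^{n,4}$ for $n\ge1$, the three-stage scheme $$U^{n,i+1}=U^{n,1}+\sum_{j=1}^{i}\hat a_{i+1,j}(-\tau L_\kappa)\bigl[\tau g_\kappa(U^{n,j})-\tau L_\kappa U^{n,1}\bigr],\qquad 1\le i\le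 3,$$ whose lower triangular coefficient matrix $\widehat A(z)=(\hat a_{i+1,j}(z))_{i,j=1}^3$ is either that of the TIF3-Ralston scheme, $$\widehat A_{\mathrm T}(z)=\begin{pmatrix}\frac1{2-z}&0&0\\[2pt]0&\frac{3}{4e^{z/2}-3z}&0\\[2pt]\frac{2e^{3z/4}}{q(z)}&\frac{3e^{z/4}}{q(z)}&\frac4{q(z)}\end{pmatrix},\qquad q(z)=e^{3z/4}(9-2z)-3e^{z/4}z-4z,$$ or that of the NIF3-Ralston scheme, $$\widehat A_{\mathrm N}(z)=\begin{pmatrix}\frac{e^{z/2}-1}z&0&0\\[2pt]0&\frac{e^{3z/4}-1}z&0\\[2pt]\frac{2e^z}9&\frac{e^{z/2}}3&\frac{e^z-1}z-\frac{e^{z/2}}3-\frac{2e^z}9\end{pmatrix},$$ where $\frac{e^{cz}-1}{z}$ is understood as $c$ at $z=0$, and where functions of the symmetric matrix $-\tau L_\kappa$ are defined on its spectrum. Let $$D(z)=\widehat A(z)^{-1}E_3+zE_3-\tfrac z2I,\qquad E_3=(1_{i\ge j})_{3\times3},$$ be the associated differentiation matrix ($D_{\mathrm T}$ or $D_{\mathrm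 N}$), and let $D_j(z)$ be its leading $j\times j$ block. Then: 1. For all $z\le0$, the symmetric part $\frac12[D_{\mathrm T}(z)+D_{\mathrm T}(z)^T]$ is positive definite and $\frac12[D_{\mathrm N}(z)+D_{\mathrm N}(z)^T]$ is positive semidefinite. 2. Both schemes preserve the original energy dissipation law at all stages: for all $n\ge1$ and $1\le j\le3$, $$E[U^{n,j+1}]-E[U^{n,1}]\le-\frac1\tau\bigl\langle\delta\vec U_{n,j+1},D_j(-\tau L_\kappa)\,\delta\vec U_{n,j+1}\bigr\rangle\le0,$$ where $\delta\vec U_{n,j+1}=(U^{n,2}-U^{n,1},\dots,U^{n,j+1}-U^{n,j})^T$. -/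

import Mathlib

open scoped Matrix InnerProductSpace NNReal

namespace GradientFlow

/-- The space `ℝ^ι` of grid functions, with the discrete `L²` inner product `⟨u, v⟩ = vᵀ u`. -/
abbrev Grid (ι : Type*) := EuclideanSpace ℝ ι

section Problem

variable {ι : Type*} [Fintype ι]

/-- The grid function which is constantly `1`. -/
noncomputable def one : Grid ι := WithLp.toLp 2 (fun _ => (1 : ℝ))

/-- `g = - δG/δv`: the gradient of `v ↦ ⟨G(v), 1⟩` at every `v` is `-g(v)`. -/
def IsNegVariationalDerivative (g G : Grid ι → Grid ι) : Prop :=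
  ∀ v : Grid ι, HasGradientAt (fun w : Grid ι => ⟪G w, one⟫_ℝ) (-g v) v

/-- The stabilized nonlinearity `g_κ(u) = κ u + g(u)`. -/
noncomputable def stabNonlin (κ : ℝ) (g : Grid ι → Grid ι) (u : Grid ι) : Grid ι := κ • u + g u

variable [DecidableEq ι]

/-- The action `A u` of a matrix on a grid function. -/
noncomputable def act (A : Matrix ι ι ℝ) (u : Grid ι) : Grid ι := Matrix.toEuclideanCLM (𝕜 := ℝ) A u

/-- The original energy `E[u] = ½ ⟨u, L u⟩ + ⟨G(u), 1⟩`. -/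
noncomputable def energy (L : Matrix ι ι ℝ) (G : Grid ι → Grid ι) (u : Grid ι) : ℝ :=
  (1 / 2) * ⟪u, act L u⟫_ℝ + ⟪G u, one⟫_ℝ

/-- The stabilized matrix `L_κ = L + κ I`. -/
def stabMatrix (κ : ℝ) (L : Matrix ι ι ℝ) : Matrix ι ι ℝ := L + κ • (1 : Matrix ι ι ℝ)

/-- The matrix function `f(-τ L_κ)`, defined on the spectrum of the symmetric matrix `-τ L_κ`
(if `-τ L_κ = Q diag(λ) Qᵀ` with `Q` orthogonal, it is `Q diag(f(λ)) Qᵀ`; the spectrum is finite,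
so that no regularity of `f` is needed). -/
noncomputable def matFun (f : ℝ → ℝ) (τ κ : ℝ) (L : Matrix ι ι ℝ) : Matrix ι ι ℝ :=
  cfc f (-τ • stabMatrix κ L)

/-- One step, of size `τ`, of the steady-state preserving three-stage explicit exponential
Runge-Kutta method with lower triangular coefficient matrix `A(z) = (â_{i+1,j}(z))`:
`U^{i+1} = U^1 + ∑_{j ≤ i} â_{i+1,j}(-τ L_κ) [τ g_κ(U^j) - τ L_κ U^1]` for `1 ≤ i ≤ 3`.
The stages `U^1, …, U^4` are `U 0, …, U 3`. -/
def IsStep (A : ℝ → Matrix (Fin 3) (Fin 3) ℝ) (L : Matrix ι ι ℝ) (κ : ℝ) (g : Grid ι → Grid ι)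
    (τ : ℝ) (U : Fin 4 → Grid ι) : Prop :=
  ∀ i : Fin 3, U i.succ = U 0 + ∑ j ∈ Finset.Iic i,
    act (matFun (fun z => A z i j) τ κ L)
      (τ • stabNonlin κ g (U j.castSucc) - τ • act (stabMatrix κ L) (U 0))

/-- `u` is a numerical solution with step sizes `τ n` and stages `U n`: the `n`-th step starts at
`U n 0 = u n` and ends at `u (n + 1) = U n 3`. -/
def IsNumericalSolution (A : ℝ → Matrix (Fin 3) (Fin 3) ℝ) (L : Matrix ι ι ℝ) (κ : ℝ)
    (g : Grid ι → Grid ι) (τ : ℕ → ℝ) (u : ℕ → Grid ι) (U : ℕ → Fin 4 → Grid ι) : Prop :=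
  ∀ n : ℕ, U n 0 = u n ∧ IsStep A L κ g (τ n) (U n) ∧ u (n + 1) = U n (Fin.last 3)

end Problem

/-- The lower triangular matrix full of ones. -/
def lowerOnes : Matrix (Fin 3) (Fin 3) ℝ := Matrix.of fun i j => if j ≤ i then 1 else 0

/-- The differentiation matrix `D(z) = A(z)⁻¹ E + z E - (z/2) I`. -/
noncomputable def diffMatrix (A : ℝ → Matrix (Fin 3) (Fin 3) ℝ) (z : ℝ) :
    Matrix (Fin 3) (Fin 3) ℝ :=
  (A z)⁻¹ * lowerOnes + z • lowerOnes - (z / 2) • (1 : Matrix (Fin 3) (Fin 3) ℝ)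

/-- The symmetric part `½ (D + Dᵀ)`. -/
noncomputable def symmPart (D : Matrix (Fin 3) (Fin 3) ℝ) : Matrix (Fin 3) (Fin 3) ℝ :=
  (1 / 2 : ℝ) • (D + Dᵀ)

/-- The quadratic form `⟨δU, D_j(-τ L_κ) δU⟩` with `δU = (U^2 - U^1, …, U^{j+1} - U^j)` and `D_j`
the leading `j × j` block of the differentiation matrix; `j : Fin 3` stands for `j + 1`. -/
noncomputable def dissipation {ι : Type*} [Fintype ι] [DecidableEq ι]
    (A : ℝ → Matrix (Fin 3) (Fin 3) ℝ) (L : Matrix ι ι ℝ) (κ τ : ℝ) (U : Fin 4 → Grid ι)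
    (j : Fin 3) : ℝ :=
  ∑ k ∈ Finset.Iic j, ∑ l ∈ Finset.Iic j,
    ⟪U k.succ - U k.castSucc,
      act (matFun (fun z => diffMatrix A z k l) τ κ L) (U l.succ - U l.castSucc)⟫_ℝ

/-- The method with coefficient matrix `A` preserves the original energy dissipation law at all
stages, for the problem data `L`, `g`, `G` and the stabilization parameter `κ`: for all step sizes,
`E[U^{n,j+1}] - E[U^{n,1}] ≤ -(1/τ) ⟨δU, D_j(-τ L_κ) δU⟩ ≤ 0` for `1 ≤ j ≤ 3`. -/
def PreservesEnergyDissipation {ι : Type*} [Fintype ι] [DecidableEq ι]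
    (A : ℝ → Matrix (Fin 3) (Fin 3) ℝ) (L : Matrix ι ι ℝ) (g G : Grid ι → Grid ι) (κ : ℝ) : Prop :=
  ∀ (τ : ℕ → ℝ) (u : ℕ → Grid ι) (U : ℕ → Fin 4 → Grid ι), (∀ n, 0 < τ n) →
    IsNumericalSolution A L κ g τ u U → ∀ (n : ℕ) (j : Fin 3),
      energy L G (U n j.succ) - energy L G (U n 0)
          ≤ -(1 / τ n) * dissipation A L κ (τ n) (U n) j ∧
        -(1 / τ n) * dissipation A L κ (τ n) (U n) j ≤ 0

/-- The entire function `(e^{c z} - 1) / z`, with value `c` at `z = 0`. -/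
noncomputable def phi (c z : ℝ) : ℝ := if z = 0 then c else (Real.exp (c * z) - 1) / z

/-- The common denominator of the last row of the TIF3-Ralston coefficients. -/
noncomputable def ralstonDenom (z : ℝ) : ℝ :=
  Real.exp (3 * z / 4) * (9 - 2 * z) - 3 * Real.exp (z / 4) * z - 4 * z

/-- The coefficient matrix of the TIF3-Ralston scheme (telescopic correction). -/
noncomputable def tif3Ralston (z : ℝ) : Matrix (Fin 3) (Fin 3) ℝ :=
  !![1 / (2 - z), 0, 0;
     0, 3 / (4 * Real.exp (z / 2) - 3 * z), 0;
     2 * Real.exp (3 * z / 4) / ralstonDenom z, 3 * Real.exp (z / 4) / ralstonDenom z,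
       4 / ralstonDenom z]

/-- The coefficient matrix of the NIF3-Ralston scheme (nonlinear-term translation correction). -/
noncomputable def nif3Ralston (z : ℝ) : Matrix (Fin 3) (Fin 3) ℝ :=
  !![phi (1 / 2) z, 0, 0;
     0, phi (3 / 4) z, 0;
     2 * Real.exp z / 9, Real.exp (z / 2) / 3,
       phi 1 z - Real.exp (z / 2) / 3 - 2 * Real.exp z / 9]

end GradientFlow

/-! The quadratic part of `E` is exact and the stabilization absorbs the Taylor remainder of `G` as
soon as `κ ≥ 2ℓ`, so one stage increment changes `E` by at most `⟪w - v, ½ L_κ (w + v) - g_κ v⟫`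
(`energy_sub_le`). In an eigenbasis of `-τ L_κ` the stage equations decouple into scalar ones, `E₃ x
= A(z) F`, with `x` the increments and `z ≤ 0` the eigenvalue; inverting `A(z)` turns `τ` times the
second slot of the estimate into `-D(z) x` (`IsStep.repr_eq`). Summing over stages and eigenvectors
leaves minus the quadratic form of `D`.

Both claims thus reduce to positivity of the symmetric part of `D(z)` for `z ≤ 0`. Its off-diagonal
entries are non-negative and it is strictly diagonally dominant (`IsDominant.posDef`); with `s =
e^{z/4}` this is elementary for either scheme. Positive definiteness comes out for both. -/

namespace GradientFlow

/-! ### Spectral calculus and the one-stage energy estimate. -/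

section Energy

variable {ι : Type*} [Fintype ι] [DecidableEq ι]

lemma cfc_mulVec_eigenvectorBasis {M : Matrix ι ι ℝ} (hM : M.IsHermitian) (f : ℝ → ℝ) (a : ι) :
    cfc f M *ᵥ ⇑(hM.eigenvectorBasis a) = f (hM.eigenvalues a) • ⇑(hM.eigenvectorBasis a) := by
  rw [hM.cfc_eq, Matrix.IsHermitian.cfc, Unitary.conjStarAlgAut_apply, ← Matrix.mulVec_mulVec,
    hM.star_eigenvectorUnitary_mulVec, ← Matrix.mulVec_mulVec,
    ← hM.eigenvectorUnitary_mulVec, ← Matrix.mulVec_smul]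
  congr 1
  ext i
  rw [Matrix.mulVec_diagonal]
  rcases eq_or_ne i a with rfl | h <;> simp [*]

/-- `cfc f M` is symmetric, so it can be moved onto the eigenvector. -/
lemma repr_act_cfc {M : Matrix ι ι ℝ} (hM : M.IsHermitian) (f : ℝ → ℝ) (x : Grid ι) (a : ι) :
    hM.eigenvectorBasis.repr (act (cfc f M) x) a =
      f (hM.eigenvalues a) * hM.eigenvectorBasis.repr x a := by
  have hC : (cfc f M)ᵀ = cfc f M := (cfc_predicate f M : IsSelfAdjoint (cfc f M))
  rw [OrthonormalBasis.repr_apply_apply, OrthonormalBasis.repr_apply_apply, act,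
    Matrix.inner_toEuclideanCLM, Matrix.dotProduct_mulVec, ← Matrix.mulVec_transpose, hC,
    cfc_mulVec_eigenvectorBasis, smul_dotProduct, EuclideanSpace.inner_eq_star_dotProduct,
    dotProduct_comm]
  simp

lemma repr_act {M : Matrix ι ι ℝ} (hM : M.IsHermitian) (x : Grid ι) (a : ι) :
    hM.eigenvectorBasis.repr (act M x) a =
      hM.eigenvalues a * hM.eigenvectorBasis.repr x a := by
  have h := repr_act_cfc hM id x a
  rwa [cfc_id ℝ M hM.isSelfAdjoint] at h

lemma act_add_mat (A B : Matrix ι ι ℝ) (x : Grid ι) : act (A + B) x = act A x + act B x := by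
  simp [act]

lemma act_smul_mat (c : ℝ) (A : Matrix ι ι ℝ) (x : Grid ι) : act (c • A) x = c • act A x := by
  simp [act]

lemma act_one (x : Grid ι) : act (1 : Matrix ι ι ℝ) x = x := by
  simp [act]

lemma act_add (A : Matrix ι ι ℝ) (x y : Grid ι) : act A (x + y) = act A x + act A y := by
  simp [act]

lemma inner_act_comm {A : Matrix ι ι ℝ} (hA : A.IsHermitian) (x y : Grid ι) :
    ⟪x, act A y⟫_ℝ = ⟪y, act A x⟫_ℝ := by
  have hA' : Aᵀ = A := hA
  rw [act, act, Matrix.inner_toEuclideanCLM, Matrix.inner_toEuclideanCLM,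
    Matrix.dotProduct_mulVec, ← Matrix.mulVec_transpose, hA', dotProduct_comm]


omit [Fintype ι] in
lemma posSemidef_stabMatrix {L : Matrix ι ι ℝ} (hL : L.PosSemidef) {κ : ℝ} (hκ : 0 ≤ κ) :
    (stabMatrix κ L).PosSemidef :=
  hL.add (Matrix.PosSemidef.one.smul hκ)

lemma eigenvalues_neg_smul_nonpos {S : Matrix ι ι ℝ} (hS : S.PosSemidef) {τ : ℝ} (hτ : 0 ≤ τ)
    (hM : (-τ • S).IsHermitian) (a : ι) : hM.eigenvalues a ≤ 0 := by
  rw [hM.eigenvalues_eq, Matrix.smul_mulVec, dotProduct_smul]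
  have := hS.dotProduct_mulVec_nonneg (⇑(hM.eigenvectorBasis a))
  simp only [RCLike.re_to_real, smul_eq_mul]
  nlinarith

omit [DecidableEq ι] in
/-- The descent inequality for a function whose gradient is Lipschitz-continuous. -/
lemma IsNegVariationalDerivative.sub_le {g G : Grid ι → Grid ι} {ℓ : ℝ≥0}
    (hG : IsNegVariationalDerivative g G) (hg : LipschitzWith ℓ g) (v w : Grid ι) :
    ⟪G w, one⟫_ℝ - ⟪G v, one⟫_ℝ ≤ -⟪g v, w - v⟫_ℝ + ℓ * ‖w - v‖ ^ 2 := by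
  -- On the segment the gradient stays within `ℓ‖w - v‖` of its value at `v`. The mean value
  -- inequality gives the factor `ℓ` instead of the sharp `ℓ/2`, which is enough for `κ ≥ 2ℓ`.
  have h := Convex.norm_image_sub_le_of_norm_hasFDerivWithin_le'
    (f := fun w : Grid ι => ⟪G w, one⟫_ℝ) (s := segment ℝ v w)
    (f' := fun x => InnerProductSpace.toDual ℝ (Grid ι) (-g x))
    (φ := InnerProductSpace.toDual ℝ (Grid ι) (-g v)) (C := ℓ * ‖w - v‖)
    (fun x _ => (hG x).hasFDerivAt.hasFDerivWithinAt)
    (fun x hx => by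
      rw [← map_sub, LinearIsometryEquiv.norm_map, neg_sub_neg, ← dist_eq_norm, ← dist_eq_norm]
      refine (hg.dist_le_mul _ _).trans (mul_le_mul_of_nonneg_left ?_ ℓ.2)
      rw [dist_eq_norm, dist_eq_norm]
      simpa only [norm_sub_rev] using norm_sub_le_of_mem_segment hx)
    (convex_segment v w) (left_mem_segment ℝ v w) (right_mem_segment ℝ v w)
  have h' := (abs_le.1 h).2
  simp only [InnerProductSpace.toDual_apply_apply, inner_neg_left] at h'
  nlinarith

/-- The stabilized energy estimate between two successive stages. -/
lemma energy_sub_le {L : Matrix ι ι ℝ} {g G : Grid ι → Grid ι} {ℓ : ℝ≥0} {κ : ℝ}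
    (hL : L.IsHermitian) (hG : IsNegVariationalDerivative g G) (hg : LipschitzWith ℓ g)
    (hκ : 2 * (ℓ : ℝ) ≤ κ) (v w : Grid ι) :
    energy L G w - energy L G v ≤
      ⟪w - v, (1 / 2 : ℝ) • act (stabMatrix κ L) (w + v) - stabNonlin κ g v⟫_ℝ := by
  have h := hG.sub_le hg v w
  have hs := inner_act_comm hL v w
  have hn : ‖w - v‖ ^ 2 = ⟪w, w⟫_ℝ - 2 * ⟪w, v⟫_ℝ + ⟪v, v⟫_ℝ := by
    rw [norm_sub_sq_real, real_inner_self_eq_norm_sq, real_inner_self_eq_norm_sq]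
  have hl : (ℓ : ℝ) * ‖w - v‖ ^ 2 ≤ κ / 2 * ‖w - v‖ ^ 2 := by
    gcongr
    linarith
  rw [hn] at hl h
  have hc := real_inner_comm v w
  simp only [energy, stabMatrix, stabNonlin, act_add_mat, act_smul_mat, act_one, act_add,
    inner_sub_left, inner_sub_right, inner_add_right, inner_smul_right,
    real_inner_comm _ (g v)] at h ⊢
  linear_combination h + hl + (1 / 2) * hs - κ / 2 * hc

omit [Fintype ι] [DecidableEq ι] in
lemma stage_succ_eq (U : Fin 4 → Grid ι) (k : Fin 3) :
    U k.succ = U 0 + ∑ l, lowerOnes k l • (U l.succ - U l.castSucc) := by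
  fin_cases k <;> simp [Fin.sum_univ_three, lowerOnes]

lemma stage_sub_eq_sum (E : Fin 4 → ℝ) (j : Fin 3) :
    E j.succ - E 0 = ∑ k ∈ Finset.Iic j, (E k.succ - E k.castSucc) := by
  fin_cases j
  · simp [show Finset.Iic (0 : Fin 3) = {0} from rfl]
  · simp [show Finset.Iic (1 : Fin 3) = {0, 1} from rfl]
    ring
  · simp [show Finset.Iic (2 : Fin 3) = {0, 1, 2} from rfl]
    ring

end Energy

/-! ### From positivity of the differentiation matrix to energy dissipation. -/

section Dissipation

variable {ι : Type*} [Fintype ι] [DecidableEq ι]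

omit [DecidableEq ι] in
lemma inner_eq_sum_repr (b : OrthonormalBasis ι ℝ (Grid ι)) (x y : Grid ι) :
    ⟪x, y⟫_ℝ = ∑ a, b.repr x a * b.repr y a := by
  rw [← b.repr.inner_map_map, PiLp.inner_apply]
  simp [mul_comm]

/-- Extending `x` by zero off `s` reduces a principal block to the full form. -/
lemma sum_nonneg_of_posSemidef_symmPart {D : Matrix (Fin 3) (Fin 3) ℝ}
    (hD : (symmPart D).PosSemidef) (s : Finset (Fin 3)) (x : Fin 3 → ℝ) :
    0 ≤ ∑ k ∈ s, ∑ l ∈ s, x k * (D k l * x l) := by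
  set y : Fin 3 → ℝ := fun k => if k ∈ s then x k else 0 with hy
  have h := hD.dotProduct_mulVec_nonneg y
  have hsymm : star y ⬝ᵥ (symmPart D *ᵥ y) = ∑ k, ∑ l, y k * (D k l * y l) := by
    simp [symmPart, dotProduct, Matrix.mulVec, Fin.sum_univ_three]
    ring
  have hrow : ∀ k, ∑ l, y k * (D k l * y l) =
      if k ∈ s then ∑ l ∈ s, x k * (D k l * x l) else 0 := by
    intro k
    by_cases hk : k ∈ s <;> simp [hy, hk, Finset.sum_ite_mem]
  rw [hsymm, Finset.sum_congr rfl fun k _ => hrow k, Finset.sum_ite_mem,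
    Finset.univ_inter] at h
  exact h

lemma dissipation_eq_sum {A : ℝ → Matrix (Fin 3) (Fin 3) ℝ} {L : Matrix ι ι ℝ} {κ τ : ℝ}
    (hM : (-τ • stabMatrix κ L).IsHermitian) (U : Fin 4 → Grid ι) (j : Fin 3) :
    dissipation A L κ τ U j = ∑ a, ∑ k ∈ Finset.Iic j, ∑ l ∈ Finset.Iic j,
      hM.eigenvectorBasis.repr (U k.succ - U k.castSucc) a *
        (diffMatrix A (hM.eigenvalues a) k l *
          hM.eigenvectorBasis.repr (U l.succ - U l.castSucc) a) := by
  simp only [dissipation, inner_eq_sum_repr hM.eigenvectorBasis, matFun, repr_act_cfc]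
  rw [Finset.sum_comm]
  simp only [Finset.sum_comm (s := Finset.univ)]
  rw [Finset.sum_comm]

/-- In the eigenbasis of `-τ L_κ`, the increments of one step satisfy
`τ (½ L_κ (U^{k+1} + U^k) - g_κ(U^k)) = -(D(-τ L_κ) δU)_k`. -/
lemma IsStep.repr_eq {A : ℝ → Matrix (Fin 3) (Fin 3) ℝ} {L : Matrix ι ι ℝ} {κ τ : ℝ}
    {g : Grid ι → Grid ι} {U : Fin 4 → Grid ι} (hU : IsStep A L κ g τ U)
    (hM : (-τ • stabMatrix κ L).IsHermitian) (a : ι)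
    (hdet : IsUnit (A (hM.eigenvalues a)).det)
    (hlow : ∀ i j, i < j → A (hM.eigenvalues a) i j = 0) (k : Fin 3) :
    τ * hM.eigenvectorBasis.repr
        ((1 / 2 : ℝ) • act (stabMatrix κ L) (U k.succ + U k.castSucc) -
          stabNonlin κ g (U k.castSucc)) a =
      -∑ l, diffMatrix A (hM.eigenvalues a) k l *
        hM.eigenvectorBasis.repr (U l.succ - U l.castSucc) a := by
  set b := hM.eigenvectorBasis with hb
  set z := hM.eigenvalues a with hz
  set x : Fin 3 → ℝ := fun l => b.repr (U l.succ - U l.castSucc) a with hx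
  set F : Fin 3 → ℝ := fun l =>
    b.repr (τ • stabNonlin κ g (U l.castSucc) - τ • act (stabMatrix κ L) (U 0)) a with hF
  have hsum : ∀ k : Fin 3, b.repr (∑ l, lowerOnes k l • (U l.succ - U l.castSucc)) a =
      (lowerOnes *ᵥ x) k := by
    intro k
    simp [hx, Matrix.mulVec, dotProduct]
  have hstage : lowerOnes *ᵥ x = A z *ᵥ F := by
    ext k
    have h := hU k
    rw [stage_succ_eq U k, add_right_inj] at h
    rw [← hsum, h, map_sum, WithLp.ofLp_sum, Finset.sum_apply]
    simp only [matFun, hb, repr_act_cfc]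
    rw [Matrix.mulVec, dotProduct]
    refine Finset.sum_subset (Finset.subset_univ _) fun i _ hi => ?_
    rw [← hz, hlow k i (by simpa using hi), zero_mul]
  have hFx : F = ((A z)⁻¹ * lowerOnes) *ᵥ x := by
    rw [← Matrix.mulVec_mulVec, hstage, Matrix.mulVec_mulVec, Matrix.nonsing_inv_mul _ hdet,
      Matrix.one_mulVec]
  have hact : ∀ y : Grid ι, τ * b.repr (act (stabMatrix κ L) y) a = -(z * b.repr y a) := by
    intro y
    rw [← repr_act hM, act_smul_mat]
    simp [hb]
  have hsucc : b.repr (U k.succ) a = b.repr (U 0) a + (lowerOnes *ᵥ x) k := by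
    rw [← hsum, ← PiLp.add_apply, ← map_add, ← stage_succ_eq]
  have hFk : F k = τ * b.repr (stabNonlin κ g (U k.castSucc)) a -
      τ * b.repr (act (stabMatrix κ L) (U 0)) a := by
    simp [hF]
  have hcs : b.repr (U k.castSucc) a = b.repr (U k.succ) a - x k := by
    simp [hx]
  have hD : ∑ l, diffMatrix A z k l * x l = F k + z * (lowerOnes *ᵥ x) k - z / 2 * x k := by
    rw [hFx]
    change (diffMatrix A z *ᵥ x) k = _
    simp [diffMatrix, Matrix.add_mulVec, Matrix.sub_mulVec, Matrix.smul_mulVec]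
  rw [hD, hFk, hact]
  have h1 := hact (U k.succ + U k.castSucc)
  simp only [map_add, PiLp.add_apply, hcs, hsucc] at h1
  simp only [map_sub, map_smul, PiLp.sub_apply, PiLp.smul_apply, smul_eq_mul]
  linear_combination (1 / 2) * h1

theorem preservesEnergyDissipation_of_posSemidef {A : ℝ → Matrix (Fin 3) (Fin 3) ℝ}
    (hdet : ∀ z ≤ 0, IsUnit (A z).det) (hlow : ∀ z i j, i < j → A z i j = 0)
    (hDlow : ∀ z ≤ 0, ∀ i j, i < j → diffMatrix A z i j = 0)
    (hD : ∀ z ≤ 0, (symmPart (diffMatrix A z)).PosSemidef)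
    {L : Matrix ι ι ℝ} {g G : Grid ι → Grid ι} {ℓ : ℝ≥0} {κ : ℝ}
    (hL : L.PosSemidef) (hG : IsNegVariationalDerivative g G) (hg : LipschitzWith ℓ g)
    (hκ : 2 * (ℓ : ℝ) ≤ κ) : PreservesEnergyDissipation A L g G κ := by
  intro τ u U hτ hU n j
  have hS := posSemidef_stabMatrix hL (κ := κ) ((by positivity : (0 : ℝ) ≤ 2 * ℓ).trans hκ)
  have hM : (-τ n • stabMatrix κ L).IsHermitian := by
    rw [neg_smul]
    exact (hS.smul (hτ n).le).isHermitian.neg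
  have hz := eigenvalues_neg_smul_nonpos hS (hτ n).le hM
  have hd := dissipation_eq_sum (A := A) hM (U n) j
  have hnonneg : 0 ≤ dissipation A L κ (τ n) (U n) j := by
    rw [hd]
    exact Finset.sum_nonneg fun a _ => sum_nonneg_of_posSemidef_symmPart (hD _ (hz a)) _ _
  refine ⟨?_, by have := hτ n; rw [neg_mul, neg_nonpos]; positivity⟩
  rw [stage_sub_eq_sum (fun k => energy L G (U n k)) j, neg_mul, one_div,
    ← div_eq_inv_mul, ← neg_div, le_div_iff₀ (hτ n)]
  calc (∑ k ∈ Finset.Iic j, (energy L G (U n k.succ) - energy L G (U n k.castSucc))) * τ n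
      ≤ (∑ k ∈ Finset.Iic j, ⟪U n k.succ - U n k.castSucc,
          (1 / 2 : ℝ) • act (stabMatrix κ L) (U n k.succ + U n k.castSucc) -
            stabNonlin κ g (U n k.castSucc)⟫_ℝ) * τ n :=
        mul_le_mul_of_nonneg_right
          (Finset.sum_le_sum fun k _ => energy_sub_le hL.isHermitian hG hg hκ _ _) (hτ n).le
    _ = -dissipation A L κ (τ n) (U n) j := by
        rw [hd, Finset.sum_mul, Finset.sum_comm, ← Finset.sum_neg_distrib]
        refine Finset.sum_congr rfl fun k hk => ?_
        rw [inner_eq_sum_repr hM.eigenvectorBasis, Finset.sum_mul, ← Finset.sum_neg_distrib]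
        refine Finset.sum_congr rfl fun a _ => ?_
        rw [mul_assoc, mul_comm _ (τ n), (hU n).2.1.repr_eq hM a
          (hdet _ (hz a)) (hlow _) k, mul_neg, ← Finset.mul_sum]
        congr 2
        -- `D` is lower triangular, so row `k ≤ j` involves only the leading block.
        refine (Finset.sum_subset (Finset.subset_univ _) fun l _ hl => ?_).symm
        rw [hDlow _ (hz a) k l, zero_mul]
        rw [Finset.mem_Iic] at hk hl
        exact hk.trans_lt (not_le.1 hl)

end Dissipation

/-! ### Diagonal dominance for the two Ralston schemes. -/

section Coefficients

lemma diffMatrix_eq {A : ℝ → Matrix (Fin 3) (Fin 3) ℝ} {z a b c d e : ℝ}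
    (hA : A z = !![a, 0, 0; 0, b, 0; c, d, e]) (ha : a ≠ 0) (hb : b ≠ 0) (he : e ≠ 0) :
    diffMatrix A z = !![1 / a + z / 2, 0, 0; 1 / b + z, 1 / b + z / 2, 0;
      (1 - c / a - d / b) / e + z, (1 - d / b) / e + z, 1 / e + z / 2] := by
  have hinv : (A z)⁻¹ = !![1 / a, 0, 0; 0, 1 / b, 0; -(c / a) / e, -(d / b) / e, 1 / e] := by
    apply Matrix.inv_eq_right_inv
    rw [hA]
    ext i j
    fin_cases i <;> fin_cases j <;> simp [Matrix.mul_apply, Fin.sum_univ_three] <;> field_simp <;>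
      ring
  have hones : lowerOnes = !![1, 0, 0; 1, 1, 0; 1, 1, 1] := by
    ext i j
    fin_cases i <;> fin_cases j <;> simp [lowerOnes]
  rw [diffMatrix, hinv, hones]
  ext i j
  fin_cases i <;> fin_cases j <;> simp <;> ring

/-- A strictly diagonally dominant symmetric part with non-negative entries is positive definite. -/
lemma posDef_symmPart_of_dominant {p q r s t u : ℝ} (hq : 0 ≤ q) (hs : 0 ≤ s) (ht : 0 ≤ t)
    (h1 : q + s < 2 * p) (h2 : q + t < 2 * r) (h3 : s + t < 2 * u) :
    (symmPart !![p, 0, 0; q, r, 0; s, t, u]).PosDef := by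
  refine Matrix.PosDef.of_dotProduct_mulVec_pos ?_ fun x hx => ?_
  · ext i j
    fin_cases i <;> fin_cases j <;> simp [symmPart] <;> ring
  · have hform : star x ⬝ᵥ (symmPart !![p, 0, 0; q, r, 0; s, t, u] *ᵥ x) =
        ((2 * p - (q + s)) * x 0 ^ 2 + (2 * r - (q + t)) * x 1 ^ 2 +
          (2 * u - (s + t)) * x 2 ^ 2) / 2 +
        (q * (x 0 + x 1) ^ 2 + s * (x 0 + x 2) ^ 2 + t * (x 1 + x 2) ^ 2) / 2 := by
      simp [symmPart, dotProduct, Matrix.mulVec, Fin.sum_univ_three]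
      ring
    rw [hform]
    have h1' := sub_pos.2 h1
    have h2' := sub_pos.2 h2
    have h3' := sub_pos.2 h3
    refine add_pos_of_pos_of_nonneg (half_pos ?_) (by positivity)
    obtain ⟨i, hi⟩ := Function.ne_iff.1 hx
    have hi' : 0 < x i ^ 2 := by
      have : x i ≠ 0 := hi
      positivity
    fin_cases i <;> simp only [Fin.zero_eta, Fin.mk_one, Fin.reduceFinMk] at hi' <;> positivity

/-- The dominance conditions on the coefficients of a method shared by both schemes. -/
structure IsDominant (A : ℝ → Matrix (Fin 3) (Fin 3) ℝ) (z a b c d e : ℝ) : Prop where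
  eq : A z = !![a, 0, 0; 0, b, 0; c, d, e]
  a_pos : 0 < a
  a_lt_b : a < b
  c_pos : 0 < c
  d_pos : 0 < d
  e_pos : 0 < e
  neg_le : -z ≤ 1 / b
  neg_le' : -z ≤ (1 - c / a - d / b) / e
  lt : (1 - d / b) / e + z < 1 / b

namespace IsDominant

variable {A : ℝ → Matrix (Fin 3) (Fin 3) ℝ} {z a b c d e : ℝ}

lemma isUnit_det (h : IsDominant A z a b c d e) : IsUnit (A z).det := by
  have hb := h.a_pos.trans h.a_lt_b
  rw [h.eq, Matrix.det_fin_three]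
  simpa using ⟨⟨h.a_pos.ne', hb.ne'⟩, h.e_pos.ne'⟩

lemma diffMatrix_eq (h : IsDominant A z a b c d e) :
    diffMatrix A z = !![1 / a + z / 2, 0, 0; 1 / b + z, 1 / b + z / 2, 0;
      (1 - c / a - d / b) / e + z, (1 - d / b) / e + z, 1 / e + z / 2] :=
  GradientFlow.diffMatrix_eq h.eq h.a_pos.ne' (h.a_pos.trans h.a_lt_b).ne' h.e_pos.ne'

lemma diffMatrix_eq_zero (h : IsDominant A z a b c d e) (i j : Fin 3) (hij : i < j) :
    diffMatrix A z i j = 0 := by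
  rw [h.diffMatrix_eq]
  fin_cases i <;> fin_cases j <;> simp_all

/-- With `s`, `t` the off-diagonal entries of the last row of `D`, the chain `0 ≤ s ≤ t < 1/b < 1/a`
gives dominance in the first two rows. In the third, `s` and `t` are below `1/e + z`, and `z ≤ 0`.
-/
lemma posDef (h : IsDominant A z a b c d e) (hz : z ≤ 0) : (symmPart (diffMatrix A z)).PosDef := by
  have ha := h.a_pos
  have hb := ha.trans h.a_lt_b
  have hc := h.c_pos
  have hd := h.d_pos
  have he := h.e_pos
  have hab := one_div_lt_one_div_of_lt ha h.a_lt_b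
  have h31 : (1 - c / a - d / b) / e ≤ (1 - d / b) / e := by
    have : 0 < c / a := by positivity
    gcongr
    linarith
  have h32 : (1 - d / b) / e < 1 / e := by
    have : 0 < d / b := by positivity
    gcongr
    linarith
  have hneg := h.neg_le
  have hneg' := h.neg_le'
  have hlt := h.lt
  rw [h.diffMatrix_eq]
  apply posDef_symmPart_of_dominant <;> linarith

end IsDominant

lemma exists_isDominant_tif3Ralston {z : ℝ} (hz : z ≤ 0) :
    ∃ a b c d e, IsDominant tif3Ralston z a b c d e := by
  obtain ⟨x, rfl⟩ : ∃ x, z = -x := ⟨-z, by ring⟩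
  have hx : 0 ≤ x := by linarith
  set s := Real.exp (-x / 4) with hs
  have hs0 : 0 < s := Real.exp_pos _
  have hs1 : s ≤ 1 := Real.exp_le_one_iff.2 (by linarith)
  have hs2 : Real.exp (-x / 2) = s ^ 2 := by rw [hs, ← Real.exp_nat_mul]; congr 1; ring
  have hs3 : Real.exp (3 * -x / 4) = s ^ 3 := by rw [hs, ← Real.exp_nat_mul]; congr 1; ring
  have hq : ralstonDenom (-x) = s ^ 3 * (9 + 2 * x) + 3 * s * x + 4 * x := by
    rw [ralstonDenom, hs3, ← hs]; ring
  have hq0 : 0 < ralstonDenom (-x) := by rw [hq]; positivity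
  have hb0 : 0 < 4 * s ^ 2 + 3 * x := by positivity
  have hs21 : s ^ 2 ≤ 1 := pow_le_one₀ hs0.le hs1
  have hs32 : s ^ 3 ≤ s ^ 2 := pow_le_pow_of_le_one hs0.le hs1 (by norm_num)
  -- The terms of `ralstonDenom` linear in `x` without `s³` cancel, leaving visibly positive
  -- entries.
  have h32 : (1 - 3 * s / ralstonDenom (-x) / (3 / (4 * s ^ 2 + 3 * x))) /
      (4 / ralstonDenom (-x)) + -x = s ^ 3 * (5 + 2 * x) / 4 := by
    field_simp
    rw [hq]
    ring
  have h31 : (1 - 2 * s ^ 3 / ralstonDenom (-x) / (1 / (2 + x)) -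
      3 * s / ralstonDenom (-x) / (3 / (4 * s ^ 2 + 3 * x))) /
      (4 / ralstonDenom (-x)) + -x = s ^ 3 / 4 := by
    field_simp
    rw [hq]
    ring
  refine ⟨1 / (2 + x), 3 / (4 * s ^ 2 + 3 * x), 2 * s ^ 3 / ralstonDenom (-x),
    3 * s / ralstonDenom (-x), 4 / ralstonDenom (-x), ?_, by positivity, ?_, by positivity,
    by positivity, by positivity, ?_, ?_, ?_⟩
  · rw [tif3Ralston, hs2, hs3, ← hs]
    ring_nf
  · rw [div_lt_div_iff₀ (by positivity) hb0]
    linarith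
  · rw [one_div_div, le_div_iff₀ (by norm_num)]
    nlinarith
  · have : 0 < s ^ 3 := by positivity
    linarith
  · rw [h32, one_div_div, lt_div_iff₀ (by norm_num)]
    have : 0 < s ^ 2 := by positivity
    nlinarith

lemma exists_isDominant_nif3Ralston {z : ℝ} (hz : z ≤ 0) :
    ∃ a b c d e, IsDominant nif3Ralston z a b c d e := by
  rcases hz.eq_or_lt with rfl | hz
  · refine ⟨1 / 2, 3 / 4, 2 / 9, 1 / 3, 4 / 9, ?_, ?_, ?_, ?_, ?_, ?_, ?_, ?_, ?_⟩ <;>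
      norm_num [nif3Ralston, phi]
  obtain ⟨x, rfl⟩ : ∃ x, z = -x := ⟨-z, by ring⟩
  have hx : 0 < x := by linarith
  set s := Real.exp (-x / 4) with hs
  have hs0 : 0 < s := Real.exp_pos _
  have hs1 : s < 1 := Real.exp_lt_one_iff.2 (by linarith)
  have hs2 : Real.exp (-x / 2) = s ^ 2 := by rw [hs, ← Real.exp_nat_mul]; congr 1; ring
  have hs4 : Real.exp (-x) = s ^ 4 := by rw [hs, ← Real.exp_nat_mul]; congr 1; ring
  have hp2 : phi (1 / 2) (-x) = (1 - s ^ 2) / x := by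
    rw [phi, if_neg hz.ne, ← hs2, show 1 / 2 * -x = -x / 2 by ring, div_neg, ← neg_div, neg_sub]
  have hp3 : phi (3 / 4) (-x) = (1 - s ^ 3) / x := by
    rw [phi, if_neg hz.ne, hs, ← Real.exp_nat_mul, div_neg, ← neg_div, neg_sub]
    congr 3; ring
  have hp4 : phi 1 (-x) = (1 - s ^ 4) / x := by
    rw [phi, if_neg hz.ne, ← hs4, one_mul, div_neg, ← neg_div, neg_sub]
  -- This is `x/4 ≤ sinh (x/4)` multiplied by `4s`. It is the only link used between `x` and `s`;
  -- the rest is polynomial in `s`, with a factor `1 - s` to spare.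
  have hxs : x * s ≤ 2 * (1 - s) * (1 + s) := by
    have h := Real.self_le_sinh_iff.2 (by positivity : 0 ≤ x / 4)
    have hexp : Real.exp (x / 4) * s = 1 := by rw [hs, ← Real.exp_add]; simp [neg_div]
    rw [Real.sinh_eq, ← neg_div, ← hs] at h
    nlinarith [mul_le_mul_of_nonneg_right h hs0.le]
  have h1s : 0 < 1 - s := sub_pos.2 hs1
  have h2 : 0 < 1 - s ^ 2 := sub_pos.2 (pow_lt_one₀ hs0.le hs1 (by norm_num))
  have h3 : 0 < 1 - s ^ 3 := sub_pos.2 (pow_lt_one₀ hs0.le hs1 (by norm_num))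
  have hmul : ∀ P : ℝ, 0 ≤ P → x * (s * P) ≤ (1 - s) * (2 * (1 + s) * P) := fun P hP => by
    nlinarith [mul_le_mul_of_nonneg_right hxs hP]
  have hw : 0 < 1 - s ^ 4 - x * (s ^ 2 / 3 + 2 * s ^ 4 / 9) := by
    have h := hmul (s / 3 + 2 * s ^ 3 / 9) (by positivity)
    have : 0 < (1 - s) * (1 + s) * (9 + 9 * s ^ 2 - 6 * s - 4 * s ^ 3) :=
      mul_pos (by positivity) (by nlinarith [mul_pos hs0 h1s, mul_pos (mul_pos hs0 hs0) h1s])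
    nlinarith
  have he : (1 - s ^ 4) / x - s ^ 2 / 3 - 2 * s ^ 4 / 9 =
      (1 - s ^ 4 - x * (s ^ 2 / 3 + 2 * s ^ 4 / 9)) / x := by
    field_simp
    ring
  refine ⟨(1 - s ^ 2) / x, (1 - s ^ 3) / x, 2 * s ^ 4 / 9, s ^ 2 / 3,
    (1 - s ^ 4 - x * (s ^ 2 / 3 + 2 * s ^ 4 / 9)) / x, ?_, by positivity, ?_, by positivity,
    by positivity, by positivity, ?_, ?_, ?_⟩
  · rw [nif3Ralston, hp2, hp3, hp4, hs2, hs4, he]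
  · have : s ^ 3 < s ^ 2 := pow_lt_pow_right_of_lt_one₀ hs0 hs1 (by norm_num)
    gcongr
  · rw [neg_neg, one_div_div, le_div_iff₀ h3]
    nlinarith [pow_pos hs0 3]
  · rw [neg_neg, le_div_iff₀ (by positivity), mul_div_cancel₀ _ hx.ne']
    -- The goal is `c/a + d/b ≤ s⁴ + x(s²/3 + 2s⁴/9)`. The term `s⁴` is shared out: `4s⁵/9` to
    -- `c/a`, the rest to `d/b`.
    have hc : 2 * s ^ 4 / 9 / ((1 - s ^ 2) / x) ≤ 2 * x * s ^ 4 / 9 + 4 * s ^ 5 / 9 := by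
      rw [div_le_iff₀ (by positivity), mul_div_assoc', le_div_iff₀ hx]
      nlinarith [hmul (s ^ 5) (by positivity)]
    have hd : s ^ 2 / 3 / ((1 - s ^ 3) / x) ≤ x * s ^ 2 / 3 + s ^ 4 * (1 - 4 * s / 9) := by
      have h := hmul (s ^ 4) (by positivity)
      have : 0 ≤ (1 - s) * s ^ 4 * (3 - s + 5 * s ^ 2 - 4 * s ^ 3) :=
        mul_nonneg (by positivity)
          (by nlinarith [mul_pos hs0 h1s, mul_pos (mul_pos hs0 hs0) h1s])
      rw [div_le_iff₀ (by positivity), mul_div_assoc', le_div_iff₀ hx]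
      nlinarith
    linarith
  · have hlt : 1 - s ^ 3 - x * s ^ 2 / 3 <
        (2 - s ^ 3) * (1 - s ^ 4 - x * (s ^ 2 / 3 + 2 * s ^ 4 / 9)) := by
      -- Collected in `x`, `hlt` reads `x s P / 9 < 1 - 2s⁴ + s⁷` with this `P`, and the right side
      -- is `(1 - s)(1 + s + s² + s³ - s⁴ - s⁵ - s⁶)`.
      have hP : 0 ≤ s * (3 + 4 * s ^ 2 - 3 * s ^ 3 - 2 * s ^ 5) := by
        have h5 : s ^ 5 ≤ s ^ 2 := pow_le_pow_of_le_one hs0.le hs1.le (by norm_num)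
        have h3 : s ^ 3 ≤ s ^ 2 := pow_le_pow_of_le_one hs0.le hs1.le (by norm_num)
        exact mul_nonneg hs0.le (by linarith)
      have h := hmul _ hP
      have : 0 < (1 - s) * (9 * (1 + s + s ^ 2 + s ^ 3 - s ^ 4 - s ^ 5 - s ^ 6) -
          2 * (1 + s) * (3 * s + 4 * s ^ 3 - 3 * s ^ 4 - 2 * s ^ 6)) := by
        have h43 : s ^ 4 ≤ s ^ 3 := pow_le_pow_of_le_one hs0.le hs1.le (by norm_num)
        have h42 : s ^ 4 ≤ s ^ 2 := pow_le_pow_of_le_one hs0.le hs1.le (by norm_num)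
        have h40 : s ^ 4 < 1 := pow_lt_one₀ hs0.le hs1 (by norm_num)
        have h51 : s ^ 5 ≤ s := pow_le_of_le_one hs0.le hs1.le (by norm_num)
        have h61 : s ^ 6 ≤ s := pow_le_of_le_one hs0.le hs1.le (by norm_num)
        have h60 : s ^ 6 ≤ 1 := pow_le_one₀ hs0.le hs1.le
        have h67 : s ^ 6 * (1 - s) ≤ 1 / 4 := by
          nlinarith [mul_le_mul_of_nonneg_right h61 h1s.le, sq_nonneg (s - 1 / 2)]
        exact mul_pos h1s (by nlinarith)
      nlinarith
    rw [← lt_sub_iff_add_lt, div_lt_iff₀ (by positivity)]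
    have hl : 1 - s ^ 2 / 3 / ((1 - s ^ 3) / x) = (1 - s ^ 3 - x * s ^ 2 / 3) / (1 - s ^ 3) := by
      field_simp
    have hr : (1 / ((1 - s ^ 3) / x) - -x) *
        ((1 - s ^ 4 - x * (s ^ 2 / 3 + 2 * s ^ 4 / 9)) / x) =
        (2 - s ^ 3) * (1 - s ^ 4 - x * (s ^ 2 / 3 + 2 * s ^ 4 / 9)) / (1 - s ^ 3) := by
      field_simp
      ring
    rw [hl, hr]
    gcongr

end Coefficients

end GradientFlow

open GradientFlow in
theorem theorem4p2 :
    (∀ z : ℝ, z ≤ 0 →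
      (symmPart (diffMatrix tif3Ralston z)).PosDef ∧
        (symmPart (diffMatrix nif3Ralston z)).PosSemidef) ∧
    ∀ {ι : Type*} [Fintype ι] [DecidableEq ι]
      (L : Matrix ι ι ℝ) (g G : Grid ι → Grid ι) (ℓ : ℝ≥0) (κ : ℝ),
      L.PosSemidef →
      (∀ v i, 0 ≤ G v i) →
      IsNegVariationalDerivative g G →
      0 < ℓ →
      LipschitzWith ℓ g →
      2 * (ℓ : ℝ) ≤ κ →
      PreservesEnergyDissipation tif3Ralston L g G κ ∧
        PreservesEnergyDissipation nif3Ralston L g G κ := by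
  have hT : ∀ z ≤ 0, (symmPart (diffMatrix tif3Ralston z)).PosDef := fun z hz =>
    let ⟨_, _, _, _, _, h⟩ := exists_isDominant_tif3Ralston hz
    h.posDef hz
  have hN : ∀ z ≤ 0, (symmPart (diffMatrix nif3Ralston z)).PosDef := fun z hz =>
    let ⟨_, _, _, _, _, h⟩ := exists_isDominant_nif3Ralston hz
    h.posDef hz
  refine ⟨fun z hz => ⟨hT z hz, (hN z hz).posSemidef⟩, ?_⟩
  intro ι _ _ L g G ℓ κ hL _ hG _ hg hκ
  constructor
  · refine preservesEnergyDissipation_of_posSemidef (fun z hz => ?_) (fun z i j hij => ?_)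
      (fun z hz => ?_) (fun z hz => (hT z hz).posSemidef) hL hG hg hκ
    · obtain ⟨_, _, _, _, _, h⟩ := exists_isDominant_tif3Ralston hz
      exact h.isUnit_det
    · fin_cases i <;> fin_cases j <;> simp_all [tif3Ralston]
    · obtain ⟨_, _, _, _, _, h⟩ := exists_isDominant_tif3Ralston hz
      exact h.diffMatrix_eq_zero
  · refine preservesEnergyDissipation_of_posSemidef (fun z hz => ?_) (fun z i j hij => ?_)
      (fun z hz => ?_) (fun z hz => (hN z hz).posSemidef) hL hG hg hκ
    · obtain ⟨_, _, _, _, _, h⟩ := exists_isDominant_nif3Ralston hz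
      exact h.isUnit_det
    · fin_cases i <;> fin_cases j <;> simp_all [nif3Ralston]
    · obtain ⟨_, _, _, _, _, h⟩ := exists_isDominant_nif3Ralston hz
      exact h.diffMatrix_eq_zero
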